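/- Let $E,A,\Gamma\in\mathbb R^{n\times n}$, $C\in\mathbb R^{p\times n}$, $B_w\in\mathbb R^{n\times q}$, $D_w\in\mathbb R^{p\times q}$ with $\operatorname{rank}E=r$, and let $E^\perp\in\mathbb R^{(n-r)\times n}$ be an orthogonal complement of $E$, i.e. $E^\perp E=0$ and $\operatorname{rank}E^\perp=n-r$. For a gain $L\in\mathbb R^{n\times p}$ consider the observer error dynamics $$E\dot e(t)=(A-LC)e(t)+(B_w-LD_w)w(t),\qquad \epsilon(t)=\Gamma e(t),\qquad t\ge 0,$$ where a solution is a function $e$ such that $Ee$ is absolutely continuous on every $[0,T]$ and $\frac{d}{dt}(Ee)(t)=(A-LC)e(t)+(B_w-LD_w)w(t)$ for almost every $t\ge0$. For $\gamma\in\mathbb R$ consider the linear matrix inequality in $X\in\mathbb R^{n\times n}$ symmetric positive definite, $Y\in\mathbb R^{(n-r)\times n}$ and $W\in\mathbb R^{p\times n}$: $$\begin{bmatrix}A^\top XE+E^\top XA+\Xi+\Gamma^\top\Gamma & *\\ B_w^\top XE+B_w^\top E^{\perp\top}Y-D_w^\top W & -\gamma I\end{bmatrix}\prec0,\qquad \Xi:=A^\top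 E^{\perp\top}Y+Y^\top E^\perp A-C^\top W-W^\top C,$$ where $*$ makes the matrix symmetric, and put $P:=XE+E^{\perp\top}Y$. Suppose that the inequality is feasible. Then it has a feasible solution $(X,Y,W)$ for which $P$ is nonsingular. Moreover, for every feasible solution for which $P$ is nonsingular, the error dynamics with gain $L=(WP^{-1})^\top$ have the following properties. (a) For $w\equiv0$ they are stable: every $s\in\mathbb C$ with $\det(sE-(A-LC))=0$ satisfies $\operatorname{Re}s<0$, and every continuous solution $e$ satisfies $e(t)\to0$ as $t\to\infty$. (b) For every solution with zero initial error ($Ee(0)=0$; in particular whenever $e(0)=0$), $$\|\epsilon\|_{L_2}^2<\gamma\,\|w\|_{L_2}^2,\qquad \|f\|_{L_2}^2:=\int\|f(t)\|_2^2\,dt .$$ This holds with the $L_2$ norms over $[0,\infty)$ for every $w\in L_2([0,\infty);\mathbb R^q)$ that does not vanish almost everywhere. For every $w\in L_\infty([0,\infty);\mathbb R^q)$, of finite energy or not, it holds with the $L_2$ norms over $[0,T]$ for every $T>0$ such that $w$ does not vanish almost everywhere on $[0,T]$. -/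

import Mathlib

open Matrix MeasureTheory Set Filter Topology

/-- `Eperp` is an orthogonal complement of the square matrix `E` of rank `r`: an
`(n - r) × n` matrix of full row rank `n - r` with `Eperp * E = 0`. -/
structure IsOrthComplement {n r : ℕ} (E : Matrix (Fin n) (Fin n) ℝ)
    (Eperp : Matrix (Fin (n - r)) (Fin n) ℝ) : Prop where
  rank_eq : E.rank = r
  mul_eq_zero : Eperp * E = 0
  rank_perp : Eperp.rank = n - r

/-- The set of finite poles `{s ∈ ℂ | det (s E - A) = 0}` of the pair `(E, A)`. -/
def finitePoles {n : ℕ} (E A : Matrix (Fin n) (Fin n) ℝ) : Set ℂ :=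
  {s | (s • E.map (algebraMap ℝ ℂ) - A.map (algebraMap ℝ ℂ)).det = 0}

/-- The linear DAE `E ẋ = A x` is stable: all finite poles lie in the open left half-plane
(in particular not every complex number is a pole, so the pair is regular). -/
def IsStablePair {n : ℕ} (E A : Matrix (Fin n) (Fin n) ℝ) : Prop :=
  finitePoles E A ⊆ {s : ℂ | s.re < 0}

/-- `e` is a (Carathéodory) solution on `[0, ∞)` of the linear DAE
`E ė(t) = A e(t) + B w(t)`: the differentiated part `t ↦ E e(t)` is absolutely continuous on
every `[0, T]` and the equation holds at almost every time `t ≥ 0`. Every classical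
(continuously differentiable) solution is one. The components of `e` that are not
differentiated in the equation are not required to be differentiable. -/
structure IsDAESolution {n q : ℕ} (E A : Matrix (Fin n) (Fin n) ℝ)
    (B : Matrix (Fin n) (Fin q) ℝ) (w : ℝ → Fin q → ℝ) (e : ℝ → Fin n → ℝ) : Prop where
  absCont : ∀ T : ℝ, 0 < T → AbsolutelyContinuousOnInterval (fun t => E *ᵥ e t) 0 T
  eqn : ∀ᵐ t ∂(volume.restrict (Ici (0 : ℝ))),
    HasDerivAt (fun τ => E *ᵥ e τ) (A *ᵥ e t + B *ᵥ w t) t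

/-- A vector signal, with values in Euclidean space. -/
def euclSignal {k : ℕ} (f : ℝ → Fin k → ℝ) : ℝ → EuclideanSpace ℝ (Fin k) :=
  fun t => WithLp.toLp 2 (f t)

/-- The squared `L²` norm `∫_S ‖f(t)‖₂² dt ∈ [0, ∞]` of a vector signal over a set `S` of
times. -/
noncomputable def l2NormSq {k : ℕ} (S : Set ℝ) (f : ℝ → Fin k → ℝ) : ENNReal :=
  eLpNorm (euclSignal f) 2 (volume.restrict S) ^ 2

/-- The matrix `P = X E + (Eperp)ᵀ Y`. -/
def lyapMatrix {n m : ℕ} (E : Matrix (Fin n) (Fin n) ℝ) (Eperp : Matrix (Fin m) (Fin n) ℝ)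
    (X : Matrix (Fin n) (Fin n) ℝ) (Y : Matrix (Fin m) (Fin n) ℝ) :
    Matrix (Fin n) (Fin n) ℝ :=
  X * E + Eperpᵀ * Y

/-- The matrix `Ξ = Aᵀ Eperpᵀ Y + Yᵀ Eperp A - Cᵀ W - Wᵀ C`. -/
def xiMatrix {n m p : ℕ} (A : Matrix (Fin n) (Fin n) ℝ) (C : Matrix (Fin p) (Fin n) ℝ)
    (Eperp : Matrix (Fin m) (Fin n) ℝ) (Y : Matrix (Fin m) (Fin n) ℝ)
    (W : Matrix (Fin p) (Fin n) ℝ) : Matrix (Fin n) (Fin n) ℝ :=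
  Aᵀ * Eperpᵀ * Y + Yᵀ * Eperp * A - Cᵀ * W - Wᵀ * C

/-- The lower left block `Bwᵀ X E + Bwᵀ Eperpᵀ Y - Dwᵀ W` of the LMI. -/
def lmiLower {n m p q : ℕ} (E : Matrix (Fin n) (Fin n) ℝ)
    (Bw : Matrix (Fin n) (Fin q) ℝ) (Dw : Matrix (Fin p) (Fin q) ℝ)
    (Eperp : Matrix (Fin m) (Fin n) ℝ) (X : Matrix (Fin n) (Fin n) ℝ)
    (Y : Matrix (Fin m) (Fin n) ℝ) (W : Matrix (Fin p) (Fin n) ℝ) :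
    Matrix (Fin q) (Fin n) ℝ :=
  Bwᵀ * X * E + Bwᵀ * Eperpᵀ * Y - Dwᵀ * W

/-- The symmetric block matrix of the LMI. -/
def lmiMatrix {n m p q : ℕ} (E A : Matrix (Fin n) (Fin n) ℝ) (C : Matrix (Fin p) (Fin n) ℝ)
    (Bw : Matrix (Fin n) (Fin q) ℝ) (Dw : Matrix (Fin p) (Fin q) ℝ)
    (Γ : Matrix (Fin n) (Fin n) ℝ) (Eperp : Matrix (Fin m) (Fin n) ℝ) (γ : ℝ)
    (X : Matrix (Fin n) (Fin n) ℝ) (Y : Matrix (Fin m) (Fin n) ℝ)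
    (W : Matrix (Fin p) (Fin n) ℝ) : Matrix (Fin n ⊕ Fin q) (Fin n ⊕ Fin q) ℝ :=
  Matrix.fromBlocks
    (Aᵀ * X * E + Eᵀ * X * A + xiMatrix A C Eperp Y W + Γᵀ * Γ)
    (lmiLower E Bw Dw Eperp X Y W)ᵀ
    (lmiLower E Bw Dw Eperp X Y W)
    (-(γ • (1 : Matrix (Fin q) (Fin q) ℝ)))

/-- `(X, Y, W)` is feasible for the LMI: `X ≻ 0` and the block matrix is negative
definite. -/
def LMIFeasible {n m p q : ℕ} (E A : Matrix (Fin n) (Fin n) ℝ) (C : Matrix (Fin p) (Fin n) ℝ)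
    (Bw : Matrix (Fin n) (Fin q) ℝ) (Dw : Matrix (Fin p) (Fin q) ℝ)
    (Γ : Matrix (Fin n) (Fin n) ℝ) (Eperp : Matrix (Fin m) (Fin n) ℝ) (γ : ℝ)
    (X : Matrix (Fin n) (Fin n) ℝ) (Y : Matrix (Fin m) (Fin n) ℝ)
    (W : Matrix (Fin p) (Fin n) ℝ) : Prop :=
  X.PosDef ∧ (-lmiMatrix E A C Bw Dw Γ Eperp γ X Y W).PosDef

/-- The error dynamics `E ė = (A - L C) e + (Bw - L Dw) w` of the observer with gain `L`. -/
def IsErrorTrajectory {n p q : ℕ} (E A : Matrix (Fin n) (Fin n) ℝ)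
    (C : Matrix (Fin p) (Fin n) ℝ) (Bw : Matrix (Fin n) (Fin q) ℝ)
    (Dw : Matrix (Fin p) (Fin q) ℝ) (L : Matrix (Fin n) (Fin p) ℝ)
    (w : ℝ → Fin q → ℝ) (e : ℝ → Fin n → ℝ) : Prop :=
  IsDAESolution E (A - L * C) (Bw - L * Dw) w e

/-- With zero disturbance the error dynamics are stable: the finite poles of `(E, A - L C)` lie
in the open left half-plane, and every continuous error trajectory tends to zero. -/
def UndisturbedStable {n p q : ℕ} (E A : Matrix (Fin n) (Fin n) ℝ)
    (C : Matrix (Fin p) (Fin n) ℝ) (Bw : Matrix (Fin n) (Fin q) ℝ)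
    (Dw : Matrix (Fin p) (Fin q) ℝ) (L : Matrix (Fin n) (Fin p) ℝ) : Prop :=
  IsStablePair E (A - L * C) ∧
    ∀ (w : ℝ → Fin q → ℝ) (e : ℝ → Fin n → ℝ), (∀ t, 0 ≤ t → w t = 0) →
      IsErrorTrajectory E A C Bw Dw L w e → ContinuousOn e (Ici 0) →
      Tendsto e atTop (𝓝 0)

/-- With zero initial error, `‖ε‖² < γ ‖w‖²` in `L²` for the performance output `ε = Γ e`.
On `[0, ∞)` this is asserted for every disturbance of finite energy that is not almost
everywhere zero; on every finite horizon `[0, T]` it is asserted for every (essentially)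
bounded disturbance that is not almost everywhere zero there. As `e` enters the dynamics
differentiated only through `E e`, zero initial error means `E e(0) = 0`; this is
implied by `e(0) = 0`. -/
def L2Performance {n p q : ℕ} (E A : Matrix (Fin n) (Fin n) ℝ)
    (C : Matrix (Fin p) (Fin n) ℝ) (Bw : Matrix (Fin n) (Fin q) ℝ)
    (Dw : Matrix (Fin p) (Fin q) ℝ) (Γ : Matrix (Fin n) (Fin n) ℝ)
    (L : Matrix (Fin n) (Fin p) ℝ) (γ : ℝ) : Prop :=
  ∀ (w : ℝ → Fin q → ℝ) (e : ℝ → Fin n → ℝ),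
    IsErrorTrajectory E A C Bw Dw L w e → E *ᵥ e 0 = 0 →
    (MemLp (euclSignal w) 2 (volume.restrict (Ici 0)) →
      ¬ (w =ᵐ[volume.restrict (Ici 0)] 0) →
      l2NormSq (Ici 0) (fun t => Γ *ᵥ e t) < ENNReal.ofReal γ * l2NormSq (Ici 0) w) ∧
    (MemLp (euclSignal w) ⊤ (volume.restrict (Ici 0)) →
      ∀ T : ℝ, 0 < T → ¬ (w =ᵐ[volume.restrict (Icc 0 T)] 0) →
      l2NormSq (Icc 0 T) (fun t => Γ *ᵥ e t) < ENNReal.ofReal γ * l2NormSq (Icc 0 T) w)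

/-!
The substitution `W = Lᵀ P`, `P = X E + Eperpᵀ Y`, turns the linear matrix inequality into a strict
dissipation inequality for the error dynamics `E ė = Ã e + B̃ w`, with `Ã = A - L C` and
`B̃ = Bw - L Dw`:
`2 (P x)ᵀ (Ã x + B̃ u) + ‖Γ x‖² + δ (‖x‖² + ‖u‖²) ≤ γ ‖u‖²` for all `x` and `u`
(`LMIFeasible.exists_isDissipative`). Since `Eperp` annihilates both `E` and `d/dt (E e)`, the first
term is, along a trajectory, the derivative of the storage function `V = (E e)ᵀ X (E e) ≥ 0`
(`IsDAESolution.deriv_storage`).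

* Evaluated at an eigenvector of the pencil, the inequality gives the location of the poles
  (`isStablePair_of_isDissipative`).
* Without input, `V' ≤ -a V` for some `a > 0`, so `V → 0` and `E e → 0`. The other components of `e`
  follow, because `x ↦ (E x, Eperp Ã x)` is injective and `Eperp Ã e = 0` along the trajectory
  (`IsDAESolution.tendsto_zero`).
* Integrated from `E e(0) = 0`, the inequality gives the `L²` bound, strict because of the term
  `δ ‖w‖²` (`IsDAESolution.l2Performance`).

A solution with `P` nonsingular is obtained by perturbing `Y`: the inequality is open and affine in
`Y`, and `det P` is a polynomial along the segment from `Y` to a matrix that is injective on `ker E`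
(`LMIFeasible.exists_isUnit`).
-/

/-! ### Quadratic forms -/

/-- Comparison of two continuous functions that are homogeneous of degree 2, the larger one positive
off the origin: `f / g` is bounded on the unit sphere. -/
theorem exists_pos_le_mul_of_homogeneous {ι : Type*} [Fintype ι] {f g : (ι → ℝ) → ℝ}
    (hf : Continuous f) (hg : Continuous g)
    (hf2 : ∀ (a : ℝ) x, f (a • x) = a ^ 2 * f x) (hg2 : ∀ (a : ℝ) x, g (a • x) = a ^ 2 * g x)
    (hpos : ∀ x, x ≠ 0 → 0 < g x) : ∃ c : ℝ, 0 < c ∧ ∀ x, f x ≤ c * g x := by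
  have hK : IsCompact (Metric.sphere (0 : ι → ℝ) 1) := isCompact_sphere 0 1
  have hne : ∀ x ∈ Metric.sphere (0 : ι → ℝ) 1, x ≠ 0 := fun x hx h => by simp [h] at hx
  obtain ⟨c, hc⟩ := hK.exists_bound_of_continuousOn (f := fun x => f x / g x)
    (hf.continuousOn.div hg.continuousOn fun x hx => (hpos x (hne x hx)).ne')
  refine ⟨|c| + 1, by positivity, fun x => ?_⟩
  rcases eq_or_ne x 0 with rfl | hx
  · have h1 : f 0 = 0 := by simpa using hf2 0 0
    have h2 : g 0 = 0 := by simpa using hg2 0 0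
    rw [h1, h2, mul_zero]
  · have hn : ‖x‖ ≠ 0 := norm_ne_zero_iff.2 hx
    have hu : ‖x‖⁻¹ • x ∈ Metric.sphere (0 : ι → ℝ) 1 := by
      rw [mem_sphere_zero_iff_norm, norm_smul, norm_inv, norm_norm, inv_mul_cancel₀ hn]
    have hb : f (‖x‖⁻¹ • x) ≤ (|c| + 1) * g (‖x‖⁻¹ • x) := by
      rw [← div_le_iff₀ (hpos _ (hne _ hu))]
      exact (le_abs_self _).trans ((hc _ hu).trans ((le_abs_self c).trans (by linarith)))
    rw [hf2, hg2, mul_left_comm] at hb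
    exact le_of_mul_le_mul_left hb (by positivity)

theorem quadForm_smul {ι : Type*} [Fintype ι] (M : Matrix ι ι ℝ) (a : ℝ) (x : ι → ℝ) :
    (a • x) ⬝ᵥ (M *ᵥ (a • x)) = a ^ 2 * (x ⬝ᵥ (M *ᵥ x)) := by
  simp only [mulVec_smul, smul_dotProduct, dotProduct_smul, smul_eq_mul]
  ring

theorem dotProduct_self_smul {ι : Type*} [Fintype ι] (a : ℝ) (x : ι → ℝ) :
    (a • x) ⬝ᵥ (a • x) = a ^ 2 * (x ⬝ᵥ x) := by
  simp only [smul_dotProduct, dotProduct_smul, smul_eq_mul]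
  ring

theorem dotProduct_self_nonneg_real {ι : Type*} [Fintype ι] (x : ι → ℝ) : 0 ≤ x ⬝ᵥ x :=
  Finset.sum_nonneg fun i _ => mul_self_nonneg (x i)

theorem dotProduct_self_pos {ι : Type*} [Fintype ι] {x : ι → ℝ} (hx : x ≠ 0) : 0 < x ⬝ᵥ x :=
  (dotProduct_self_nonneg_real x).lt_of_ne fun h => hx (dotProduct_self_eq_zero.1 h.symm)

theorem Matrix.PosDef.quadForm_pos {ι : Type*} [Fintype ι] {M : Matrix ι ι ℝ} (hM : M.PosDef)
    {x : ι → ℝ} (hx : x ≠ 0) : 0 < x ⬝ᵥ (M *ᵥ x) := by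
  simpa using hM.dotProduct_mulVec_pos hx

theorem Matrix.PosDef.quadForm_nonneg {ι : Type*} [Fintype ι] {M : Matrix ι ι ℝ} (hM : M.PosDef)
    (x : ι → ℝ) : 0 ≤ x ⬝ᵥ (M *ᵥ x) := by
  simpa using hM.posSemidef.dotProduct_mulVec_nonneg x

theorem Matrix.PosDef.transpose_eq {ι : Type*} [Fintype ι] {M : Matrix ι ι ℝ} (hM : M.PosDef) :
    Mᵀ = M := by
  rw [← conjTranspose_eq_transpose_of_trivial, hM.isHermitian.eq]

/-- A positive definite matrix dominates a positive multiple of the identity. -/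
theorem Matrix.PosDef.exists_pos_mul_dotProduct_le {ι : Type*} [Fintype ι] {M : Matrix ι ι ℝ}
    (hM : M.PosDef) : ∃ δ : ℝ, 0 < δ ∧ ∀ x, δ * (x ⬝ᵥ x) ≤ x ⬝ᵥ (M *ᵥ x) := by
  obtain ⟨c, hc, h⟩ := exists_pos_le_mul_of_homogeneous (f := fun x : ι → ℝ => x ⬝ᵥ x)
    (g := fun x => x ⬝ᵥ (M *ᵥ x)) (by fun_prop) (by fun_prop) dotProduct_self_smul
    (quadForm_smul M) (fun x hx => hM.quadForm_pos hx)
  exact ⟨c⁻¹, inv_pos.2 hc, fun x => (inv_mul_le_iff₀ hc).2 (h x)⟩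

/-- Positive definiteness survives small symmetric perturbations in a fixed direction. -/
theorem Matrix.PosDef.exists_add_smul {ι : Type*} [Fintype ι] {M N : Matrix ι ι ℝ}
    (hM : M.PosDef) (hN : N.IsHermitian) :
    ∃ ε₀ : ℝ, 0 < ε₀ ∧ ∀ ε ∈ Ioo 0 ε₀, (M + ε • N).PosDef := by
  obtain ⟨c, hc, h⟩ := exists_pos_le_mul_of_homogeneous (f := fun x : ι → ℝ => x ⬝ᵥ ((-N) *ᵥ x))
    (g := fun x => x ⬝ᵥ (M *ᵥ x)) (by fun_prop) (by fun_prop) (quadForm_smul (-N))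
    (quadForm_smul M) fun x hx => hM.quadForm_pos hx
  refine ⟨c⁻¹, inv_pos.2 hc, fun ε hε => .of_dotProduct_mulVec_pos ?_ fun x hx => ?_⟩
  · exact hM.isHermitian.add (by rw [IsHermitian, conjTranspose_smul, hN.eq, star_trivial])
  · have h1 := h x
    have h2 := hM.quadForm_pos hx
    have h3 : ε * c < 1 := by
      have := mul_lt_mul_of_pos_right hε.2 hc
      rwa [inv_mul_cancel₀ hc.ne'] at this
    simp only [star_trivial, add_mulVec, smul_mulVec, dotProduct_add, dotProduct_smul,
      smul_eq_mul, neg_mulVec, dotProduct_neg] at h1 ⊢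
    nlinarith [hε.1]

/-! ### Nonsingularity of the Lyapunov matrix -/

/-- `Eperpᵀ Y` is invisible to directions annihilated by `Eperp`: these are the range of `E` and, along
trajectories, the right-hand side of the equation. -/
theorem lyapMatrix_dotProduct {n m : ℕ} (E : Matrix (Fin n) (Fin n) ℝ)
    (Eperp : Matrix (Fin m) (Fin n) ℝ) (X : Matrix (Fin n) (Fin n) ℝ)
    (Y : Matrix (Fin m) (Fin n) ℝ) (x d : Fin n → ℝ) :
    (lyapMatrix E Eperp X Y *ᵥ x) ⬝ᵥ d = (X *ᵥ (E *ᵥ x)) ⬝ᵥ d + (Y *ᵥ x) ⬝ᵥ (Eperp *ᵥ d) := by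
  rw [lyapMatrix, add_mulVec, add_dotProduct, ← mulVec_mulVec, ← mulVec_mulVec,
    mulVec_transpose, ← dotProduct_mulVec]

/-- As `ker E` has dimension `n - r`, some `(n - r) × n` matrix is injective on it. -/
theorem IsOrthComplement.exists_injective_on_ker {n r : ℕ} {E : Matrix (Fin n) (Fin n) ℝ}
    {Eperp : Matrix (Fin (n - r)) (Fin n) ℝ} (hE : IsOrthComplement E Eperp) :
    ∃ Z : Matrix (Fin (n - r)) (Fin n) ℝ, ∀ v, E *ᵥ v = 0 → Z *ᵥ v = 0 → v = 0 := by
  let K := LinearMap.ker E.mulVecLin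
  have hK : Module.finrank ℝ K = Module.finrank ℝ (Fin (n - r) → ℝ) := by
    have h1 := E.mulVecLin.finrank_range_add_finrank_ker
    have h2 : Module.finrank ℝ (LinearMap.range E.mulVecLin) = r := hE.rank_eq
    simp only [Module.finrank_fin_fun] at h1 ⊢
    change Module.finrank ℝ (LinearMap.ker E.mulVecLin) = _
    omega
  let φ : K ≃ₗ[ℝ] (Fin (n - r) → ℝ) := LinearEquiv.ofFinrankEq _ _ hK
  obtain ⟨g, hg⟩ := LinearMap.exists_extend φ.toLinearMap
  refine ⟨LinearMap.toMatrix' g, fun v hv hz => ?_⟩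
  rw [LinearMap.toMatrix'_mulVec] at hz
  have h3 : φ ⟨v, hv⟩ = 0 := by
    rw [← hz]
    exact (LinearMap.congr_fun hg ⟨v, hv⟩).symm
  have h4 := φ.map_eq_zero_iff.1 h3
  exact congrArg Subtype.val h4

/-- If `Z` is injective on `ker E` then `X E + Eperpᵀ Z` is nonsingular: the ranges of `E` and
`Eperpᵀ` are orthogonal, so pairing `X E v + Eperpᵀ Z v = 0` with `E v` gives `E v = 0`, and then
`Z v = 0` because `Eperpᵀ` is injective. -/
theorem IsOrthComplement.exists_isUnit_lyapMatrix {n r : ℕ} {E : Matrix (Fin n) (Fin n) ℝ}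
    {Eperp : Matrix (Fin (n - r)) (Fin n) ℝ} (hE : IsOrthComplement E Eperp)
    {X : Matrix (Fin n) (Fin n) ℝ} (hX : X.PosDef) :
    ∃ Z : Matrix (Fin (n - r)) (Fin n) ℝ, IsUnit (lyapMatrix E Eperp X Z) := by
  obtain ⟨Z, hZ⟩ := hE.exists_injective_on_ker
  refine ⟨Z, mulVec_injective_iff_isUnit.1 ?_⟩
  rw [← coe_mulVecLin, injective_iff_map_eq_zero]
  intro v hv
  rw [mulVecLin_apply] at hv
  have h1 : E *ᵥ v = 0 := by
    by_contra hne
    have h := lyapMatrix_dotProduct E Eperp X Z v (E *ᵥ v)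
    rw [hv, mulVec_mulVec v Eperp E, hE.mul_eq_zero, zero_mulVec, zero_dotProduct, dotProduct_zero,
      add_zero, dotProduct_comm] at h
    exact (hX.quadForm_pos hne).ne h
  refine hZ v h1 ?_
  have h2 : Eperpᵀ *ᵥ (Z *ᵥ v) = 0 := by
    rw [lyapMatrix, add_mulVec, ← mulVec_mulVec, ← mulVec_mulVec, h1, mulVec_zero, zero_add] at hv
    exact hv
  have hinj : Function.Injective Eperpᵀ.mulVec := by
    rw [mulVec_injective_iff, linearIndependent_iff_card_eq_finrank_span, Fintype.card_fin,
      Set.finrank, ← rank_eq_finrank_span_cols, rank_transpose, hE.rank_perp]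
  exact hinj (h2.trans (mulVec_zero _).symm)

/-- The polynomial `det (P + t D)` does not vanish at `t = 1`, so it has finitely many roots. -/
theorem exists_isUnit_add_smul {ι : Type*} [Fintype ι] [DecidableEq ι] (P D : Matrix ι ι ℝ)
    (h : IsUnit (P + D)) {ε₀ : ℝ} (hε₀ : 0 < ε₀) : ∃ ε ∈ Ioo 0 ε₀, IsUnit (P + ε • D) := by
  let p : Polynomial ℝ := (P.map Polynomial.C + (Polynomial.X : Polynomial ℝ) • D.map Polynomial.C).det
  have hp : ∀ t : ℝ, p.eval t = (P + t • D).det := fun t => by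
    rw [← Polynomial.coe_evalRingHom, RingHom.map_det]
    congr 1
    ext i j
    simpa using mul_comm (D i j) t
  have hp0 : p ≠ 0 := fun h0 => by
    have h1 := hp 1
    rw [h0, Polynomial.eval_zero, one_smul] at h1
    exact ((isUnit_iff_isUnit_det _).1 h).ne_zero h1.symm
  obtain ⟨ε, hε, hr⟩ := (Ioo_infinite hε₀).exists_notMem_finset p.roots.toFinset
  refine ⟨ε, hε, (isUnit_iff_isUnit_det _).2 (isUnit_iff_ne_zero.2 fun h0 => hr ?_)⟩
  rw [Multiset.mem_toFinset, Polynomial.mem_roots hp0, Polynomial.IsRoot, hp, h0]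

/-! ### The linear matrix inequality -/

section LMI

variable {n m p q : ℕ} {E A : Matrix (Fin n) (Fin n) ℝ} {C : Matrix (Fin p) (Fin n) ℝ}
  {Bw : Matrix (Fin n) (Fin q) ℝ} {Dw : Matrix (Fin p) (Fin q) ℝ}
  {Γ : Matrix (Fin n) (Fin n) ℝ} {Eperp : Matrix (Fin m) (Fin n) ℝ} {γ : ℝ}
  {X : Matrix (Fin n) (Fin n) ℝ} {Y : Matrix (Fin m) (Fin n) ℝ} {W : Matrix (Fin p) (Fin n) ℝ}

theorem lmiMatrix_isHermitian (hX : X.IsHermitian) :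
    (lmiMatrix E A C Bw Dw Γ Eperp γ X Y W).IsHermitian := by
  rw [IsHermitian, conjTranspose_eq_transpose_of_trivial] at *
  rw [lmiMatrix, fromBlocks_transpose, transpose_transpose]
  congr 1
  · simp only [xiMatrix, transpose_add, transpose_sub, transpose_mul, transpose_transpose, hX,
      Matrix.mul_assoc]
    abel
  · simp

/-- The matrix of the linear matrix inequality is affine in `Y`. -/
theorem lmiMatrix_add_smul (Z : Matrix (Fin m) (Fin n) ℝ) (ε : ℝ) :
    lmiMatrix E A C Bw Dw Γ Eperp γ X (Y + ε • (Z - Y)) W =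
      lmiMatrix E A C Bw Dw Γ Eperp γ X Y W +
        ε • (lmiMatrix E A C Bw Dw Γ Eperp γ X Z W - lmiMatrix E A C Bw Dw Γ Eperp γ X Y W) := by
  have h21 : lmiLower E Bw Dw Eperp X (Y + ε • (Z - Y)) W = lmiLower E Bw Dw Eperp X Y W +
      ε • (lmiLower E Bw Dw Eperp X Z W - lmiLower E Bw Dw Eperp X Y W) := by
    simp only [lmiLower, Matrix.mul_add, Matrix.mul_sub, Matrix.mul_smul]
    module
  unfold lmiMatrix
  rw [h21]
  simp only [sub_eq_add_neg (fromBlocks _ _ _ _), fromBlocks_neg, fromBlocks_add, fromBlocks_smul]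
  refine fromBlocks_inj.2 ⟨?_, ?_, ?_, ?_⟩
  · simp only [xiMatrix, transpose_add, transpose_smul, transpose_sub, Matrix.mul_add,
      Matrix.add_mul, Matrix.mul_sub, Matrix.sub_mul, Matrix.mul_smul, Matrix.smul_mul]
    module
  · simp only [transpose_add, transpose_neg, transpose_smul, sub_eq_add_neg]
  · module
  · module

/-- Moving `Y` slightly towards a `Z` for which `X E + Eperpᵀ Z` is nonsingular keeps the inequality
and makes `X E + Eperpᵀ Y` nonsingular. -/
theorem LMIFeasible.exists_isUnit {n r p q : ℕ} {E A : Matrix (Fin n) (Fin n) ℝ}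
    {C : Matrix (Fin p) (Fin n) ℝ} {Bw : Matrix (Fin n) (Fin q) ℝ} {Dw : Matrix (Fin p) (Fin q) ℝ}
    {Γ : Matrix (Fin n) (Fin n) ℝ} {Eperp : Matrix (Fin (n - r)) (Fin n) ℝ} {γ : ℝ}
    {X : Matrix (Fin n) (Fin n) ℝ} {Y : Matrix (Fin (n - r)) (Fin n) ℝ}
    {W : Matrix (Fin p) (Fin n) ℝ} (hE : IsOrthComplement E Eperp)
    (h : LMIFeasible E A C Bw Dw Γ Eperp γ X Y W) :
    ∃ Y', LMIFeasible E A C Bw Dw Γ Eperp γ X Y' W ∧ IsUnit (lyapMatrix E Eperp X Y') := by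
  obtain ⟨Z, hZ⟩ := hE.exists_isUnit_lyapMatrix h.1
  have hH : ∀ Y, (lmiMatrix E A C Bw Dw Γ Eperp γ X Y W).IsHermitian := fun Y =>
    lmiMatrix_isHermitian h.1.isHermitian
  obtain ⟨ε₀, hε₀, hpd⟩ := h.2.exists_add_smul (N := lmiMatrix E A C Bw Dw Γ Eperp γ X Y W -
    lmiMatrix E A C Bw Dw Γ Eperp γ X Z W) ((hH Y).sub (hH Z))
  have hP : ∀ ε : ℝ, lyapMatrix E Eperp X (Y + ε • (Z - Y)) =
      lyapMatrix E Eperp X Y + ε • (Eperpᵀ * (Z - Y)) := fun ε => by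
    simp only [lyapMatrix, Matrix.mul_add, Matrix.mul_smul, add_assoc]
  obtain ⟨ε, hε, hu⟩ := exists_isUnit_add_smul (lyapMatrix E Eperp X Y) (Eperpᵀ * (Z - Y))
    (by have := hP 1; rw [one_smul, one_smul, add_sub_cancel] at this; rwa [← this]) hε₀
  refine ⟨Y + ε • (Z - Y), ⟨h.1, ?_⟩, (hP ε) ▸ hu⟩
  convert hpd ε hε using 1
  rw [lmiMatrix_add_smul]
  module

/-- The strict dissipation inequality `2 (P x)ᵀ (A x + B u) + ‖Γ x‖² + δ (‖x‖² + ‖u‖²) ≤ γ ‖u‖²`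
for all `x` and `u`. Along trajectories of `E ė = A e + B w`, with `P` the matrix `lyapMatrix`, its
first term is the derivative of the storage function `(E e)ᵀ X (E e)`. -/
def IsDissipative {n q : ℕ} (A : Matrix (Fin n) (Fin n) ℝ) (B : Matrix (Fin n) (Fin q) ℝ)
    (Γ P : Matrix (Fin n) (Fin n) ℝ) (γ δ : ℝ) : Prop :=
  ∀ (x : Fin n → ℝ) (u : Fin q → ℝ),
    2 * ((P *ᵥ x) ⬝ᵥ (A *ᵥ x + B *ᵥ u)) + (Γ *ᵥ x) ⬝ᵥ (Γ *ᵥ x) + δ * (x ⬝ᵥ x + u ⬝ᵥ u) ≤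
      γ * (u ⬝ᵥ u)

/-- With `W = Lᵀ P` the linear matrix inequality is the dissipation inequality of the error dynamics:
its upper left block is `(A - L C)ᵀ P + Pᵀ (A - L C) + Γᵀ Γ`, its lower left block
`(Bw - L Dw)ᵀ P`. -/
theorem LMIFeasible.exists_isDissipative (h : LMIFeasible E A C Bw Dw Γ Eperp γ X Y W)
    {L : Matrix (Fin n) (Fin p) ℝ}
    (hL : W = Lᵀ * lyapMatrix E Eperp X Y) :
    ∃ δ : ℝ, 0 < δ ∧
      IsDissipative (A - L * C) (Bw - L * Dw) Γ (lyapMatrix E Eperp X Y) γ δ := by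
  obtain ⟨δ, hδ, hq⟩ := h.2.exists_pos_mul_dotProduct_le
  refine ⟨δ, hδ, fun x u => ?_⟩
  have hX : Xᵀ = X := h.1.transpose_eq
  set P := lyapMatrix E Eperp X Y with hP
  have h11 : Aᵀ * X * E + Eᵀ * X * A + xiMatrix A C Eperp Y W + Γᵀ * Γ =
      (A - L * C)ᵀ * P + Pᵀ * (A - L * C) + Γᵀ * Γ := by
    rw [xiMatrix, hL, hP, lyapMatrix]
    simp only [transpose_add, transpose_sub, transpose_mul, transpose_transpose, hX,
      Matrix.mul_assoc, Matrix.mul_add, Matrix.add_mul, Matrix.sub_mul, Matrix.mul_sub]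
    abel
  have h21 : lmiLower E Bw Dw Eperp X Y W = (Bw - L * Dw)ᵀ * P := by
    rw [lmiLower, hL, hP, lyapMatrix]
    simp only [transpose_sub, transpose_mul,
      Matrix.mul_assoc, Matrix.mul_add, Matrix.sub_mul]
    abel
  have hq' := hq (Sum.elim x u)
  rw [lmiMatrix, h11, h21, neg_mulVec, fromBlocks_mulVec] at hq'
  simp only [Sum.elim_comp_inl, Sum.elim_comp_inr, dotProduct_neg, sumElim_dotProduct_sumElim,
    add_mulVec, dotProduct_add, transpose_mul, transpose_transpose, neg_mulVec, smul_mulVec,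
    one_mulVec, dotProduct_smul, smul_eq_mul, ← mulVec_mulVec] at hq'
  have t1 : ∀ {k l : ℕ} (M : Matrix (Fin k) (Fin l) ℝ) (a : Fin l → ℝ) (b : Fin k → ℝ),
      a ⬝ᵥ (Mᵀ *ᵥ b) = (M *ᵥ a) ⬝ᵥ b := fun M a b => by
    rw [dotProduct_mulVec, vecMul_transpose]
  simp only [t1] at hq'
  rw [dotProduct_comm ((A - L * C) *ᵥ x), dotProduct_comm ((Bw - L * Dw) *ᵥ u)] at hq'
  rw [dotProduct_add]
  linarith

end LMI

/-! ### Finite poles -/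

/-- For `s E v = A v` with `v = a + i b ≠ 0`, adding the dissipation inequalities at `a` and at `b`
without input bounds `2 Re s · ((E a)ᵀ X (E a) + (E b)ᵀ X (E b))` above by a negative number; the
terms with `Im s` cancel as `X` is symmetric. -/
theorem isStablePair_of_isDissipative {n m q : ℕ} {E A : Matrix (Fin n) (Fin n) ℝ}
    {B : Matrix (Fin n) (Fin q) ℝ} {Γ : Matrix (Fin n) (Fin n) ℝ} {Eperp : Matrix (Fin m) (Fin n) ℝ}
    {X : Matrix (Fin n) (Fin n) ℝ} {Y : Matrix (Fin m) (Fin n) ℝ} {γ δ : ℝ}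
    (hEperp : Eperp * E = 0) (hX : X.PosDef) (hδ : 0 < δ)
    (hdiss : IsDissipative A B Γ (lyapMatrix E Eperp X Y) γ δ) :
    IsStablePair E A := by
  intro s hs
  obtain ⟨v, hv0, hv⟩ := exists_mulVec_eq_zero_iff.2 (mem_ofPred_eq ▸ hs)
  let a : Fin n → ℝ := fun i => (v i).re
  let b : Fin n → ℝ := fun i => (v i).im
  have hre : ∀ M : Matrix (Fin n) (Fin n) ℝ, ∀ i,
      ((M.map (algebraMap ℝ ℂ)) *ᵥ v) i = ⟨(M *ᵥ a) i, (M *ᵥ b) i⟩ := fun M i => by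
    apply Complex.ext <;> simp [mulVec, dotProduct, a, b]
  have hc : ∀ i, s * ((E.map (algebraMap ℝ ℂ)) *ᵥ v) i = ((A.map (algebraMap ℝ ℂ)) *ᵥ v) i := by
    intro i
    have := congrFun hv i
    rw [sub_mulVec, smul_mulVec, Pi.sub_apply, Pi.smul_apply, Pi.zero_apply, sub_eq_zero] at this
    exact this
  have hA : A *ᵥ a = s.re • (E *ᵥ a) - s.im • (E *ᵥ b) := by
    ext i
    have := congrArg Complex.re (hc i)
    simp only [hre, Complex.mul_re] at this
    simpa using this.symm
  have hB : A *ᵥ b = s.re • (E *ᵥ b) + s.im • (E *ᵥ a) := by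
    ext i
    have := congrArg Complex.im (hc i)
    simp only [hre, Complex.mul_im] at this
    simpa using this.symm
  have hP : ∀ x y, (lyapMatrix E Eperp X Y *ᵥ x) ⬝ᵥ (E *ᵥ y) = (X *ᵥ (E *ᵥ x)) ⬝ᵥ (E *ᵥ y) := by
    intro x y
    rw [lyapMatrix_dotProduct, mulVec_mulVec y Eperp E, hEperp, zero_mulVec, dotProduct_zero,
      add_zero]
  have hsym : (X *ᵥ (E *ᵥ a)) ⬝ᵥ (E *ᵥ b) = (X *ᵥ (E *ᵥ b)) ⬝ᵥ (E *ᵥ a) := by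
    have hXt : Xᵀ = X := hX.transpose_eq
    rw [dotProduct_comm, dotProduct_mulVec, ← mulVec_transpose, hXt]
  have hV : ∀ x, 0 ≤ (X *ᵥ (E *ᵥ x)) ⬝ᵥ (E *ᵥ x) := fun x => by
    rw [dotProduct_comm]
    exact hX.quadForm_nonneg (E *ᵥ x)
  have ha := hdiss a 0
  have hb := hdiss b 0
  simp only [mulVec_zero, add_zero, dotProduct_zero, mul_zero] at ha hb
  rw [hA, dotProduct_sub, dotProduct_smul, dotProduct_smul, hP, hP, smul_eq_mul, smul_eq_mul] at ha
  rw [hB, dotProduct_add, dotProduct_smul, dotProduct_smul, hP, hP, smul_eq_mul, smul_eq_mul] at hb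
  rw [hsym] at ha
  have hab : 0 < a ⬝ᵥ a + b ⬝ᵥ b := by
    by_cases h : a = 0
    · have hbne : b ≠ 0 := fun h' => hv0 (funext fun i =>
        Complex.ext (congrFun h i) (congrFun h' i))
      linarith [dotProduct_self_nonneg_real a, dotProduct_self_pos hbne]
    · linarith [dotProduct_self_nonneg_real b, dotProduct_self_pos h]
  have h1 := dotProduct_self_nonneg_real (Γ *ᵥ a)
  have h2 := dotProduct_self_nonneg_real (Γ *ᵥ b)
  have h3 := mul_pos hδ hab
  by_contra hneg
  have hs0 : 0 ≤ s.re := not_lt.1 hneg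
  have h4 := mul_nonneg hs0 (hV a)
  have h5 := mul_nonneg hs0 (hV b)
  linarith

/-! ### Absolutely continuous functions and quadratic forms -/

theorem AbsolutelyContinuousOnInterval.apply {ι : Type*} [Fintype ι] {f : ℝ → ι → ℝ} {a b : ℝ}
    (hf : AbsolutelyContinuousOnInterval f a b) (i : ι) :
    AbsolutelyContinuousOnInterval (fun t => f t i) a b :=
  squeeze_zero (fun _ => Finset.sum_nonneg fun _ _ => dist_nonneg)
    (fun _ => Finset.sum_le_sum fun _ _ => dist_le_pi_dist _ _ i) hf

theorem AbsolutelyContinuousOnInterval.finset_sum {ι : Type*} (s : Finset ι) {f : ι → ℝ → ℝ}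
    {a b : ℝ} (hf : ∀ i ∈ s, AbsolutelyContinuousOnInterval (f i) a b) :
    AbsolutelyContinuousOnInterval (fun t => ∑ i ∈ s, f i t) a b := by
  classical
  induction s using Finset.induction_on with
  | empty => simpa [AbsolutelyContinuousOnInterval] using tendsto_const_nhds
  | insert i s hi ih =>
    simp only [Finset.sum_insert hi]
    exact (hf i (Finset.mem_insert_self i s)).fun_add
      (ih fun j hj => hf j (Finset.mem_insert_of_mem hj))

theorem AbsolutelyContinuousOnInterval.quadForm {ι : Type*} [Fintype ι] {g : ℝ → ι → ℝ}
    {a b : ℝ} (hg : AbsolutelyContinuousOnInterval g a b) (M : Matrix ι ι ℝ) :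
    AbsolutelyContinuousOnInterval (fun t => g t ⬝ᵥ (M *ᵥ g t)) a b := by
  simp only [dotProduct, mulVec]
  exact .finset_sum _ fun i _ => (hg.apply i).fun_mul
    (.finset_sum _ fun j _ => (hg.apply j).const_mul (M i j))

theorem HasDerivAt.mulVec {ι κ : Type*} [Fintype ι] [Fintype κ] {g : ℝ → ι → ℝ} {g' : ι → ℝ}
    {t : ℝ} (hg : HasDerivAt g g' t) (M : Matrix κ ι ℝ) :
    HasDerivAt (fun τ => M *ᵥ g τ) (M *ᵥ g') t :=
  (LinearMap.toContinuousLinearMap M.mulVecLin).hasFDerivAt.comp_hasDerivAt t hg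

theorem HasDerivAt.quadForm {ι : Type*} [Fintype ι] {g : ℝ → ι → ℝ} {g' : ι → ℝ} {t : ℝ}
    (hg : HasDerivAt g g' t) {M : Matrix ι ι ℝ} (hM : Mᵀ = M) :
    HasDerivAt (fun τ => g τ ⬝ᵥ (M *ᵥ g τ)) (2 * ((M *ᵥ g t) ⬝ᵥ g')) t := by
  have h : HasDerivAt (fun τ => ∑ i, g τ i * (M *ᵥ g τ) i)
      (∑ i, (g' i * (M *ᵥ g t) i + g t i * (M *ᵥ g') i)) t :=
    .fun_sum fun i _ => (hasDerivAt_pi.1 hg i).mul (hasDerivAt_pi.1 (hg.mulVec M) i)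
  refine h.congr_deriv ?_
  rw [Finset.sum_add_distrib]
  change g' ⬝ᵥ (M *ᵥ g t) + g t ⬝ᵥ (M *ᵥ g') = _
  rw [dotProduct_mulVec (g t), ← mulVec_transpose, hM, dotProduct_comm g']
  ring

/-- A nonnegative locally absolutely continuous function with `v' ≤ -a v` almost everywhere tends to
zero: it is nonincreasing, so `a T v(T) ≤ a ∫₀ᵀ v ≤ v(0)`. -/
theorem tendsto_zero_of_deriv_le {v : ℝ → ℝ} {a : ℝ} (ha : 0 < a)
    (hac : ∀ T, 0 < T → AbsolutelyContinuousOnInterval v 0 T) (hv : ∀ t, 0 ≤ v t)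
    (hd : ∀ᵐ t ∂(volume.restrict (Ici (0 : ℝ))), deriv v t ≤ -(a * v t)) :
    Tendsto v atTop (𝓝 0) := by
  have hac' : ∀ s t, 0 ≤ s → s < t → AbsolutelyContinuousOnInterval v s t := fun s t hs hst =>
    (hac t (hs.trans_lt hst)).mono (by
      rw [uIcc_of_le hst.le, uIcc_of_le (hs.trans hst.le)]; exact Icc_subset_Icc_left hs)
  have hbound : ∀ s t c : ℝ, 0 ≤ s → s < t → (∀ τ ∈ Icc s t, -(a * v τ) ≤ c) →
      v t - v s ≤ (t - s) * c := by
    intro s t c hs hst hc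
    have h := intervalIntegral.integral_mono_ae_restrict hst.le
      (hac' s t hs hst).intervalIntegrable_deriv (g := fun _ => c)
      intervalIntegrable_const ?_
    · rwa [(hac' s t hs hst).integral_deriv_eq_sub, intervalIntegral.integral_const,
        smul_eq_mul] at h
    · filter_upwards [ae_restrict_of_ae_restrict_of_subset
        (fun τ hτ => hs.trans hτ.1 : Icc s t ⊆ Ici 0) hd, ae_restrict_mem measurableSet_Icc]
        with τ h1 h2
      exact h1.trans (hc τ h2)
  have hanti : ∀ s t, 0 ≤ s → s ≤ t → v t ≤ v s := by
    intro s t hs hst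
    rcases hst.eq_or_lt with rfl | hst
    · exact le_rfl
    · have := hbound s t 0 hs hst fun τ _ => by simpa using mul_nonneg ha.le (hv τ)
      linarith
  -- By monotonicity `v' ≤ -a v(T)` on all of `[0, T]`.
  have hle : ∀ T, 0 < T → v T ≤ v 0 / a * T⁻¹ := by
    intro T hT
    have := hbound 0 T (-(a * v T)) le_rfl hT fun τ hτ =>
      neg_le_neg (mul_le_mul_of_nonneg_left (hanti τ T hτ.1 hτ.2) ha.le)
    rw [← div_eq_mul_inv, div_div, le_div_iff₀ (by positivity)]
    nlinarith [hv T]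
  refine squeeze_zero' (.of_forall hv) ((eventually_gt_atTop 0).mono hle) ?_
  simpa using tendsto_inv_atTop_zero.const_mul (v 0 / a)

/-! ### Storage function and decay along trajectories -/

section Trajectory

variable {n m q : ℕ} {E A : Matrix (Fin n) (Fin n) ℝ} {B : Matrix (Fin n) (Fin q) ℝ}
  {Γ : Matrix (Fin n) (Fin n) ℝ} {Eperp : Matrix (Fin m) (Fin n) ℝ}
  {X : Matrix (Fin n) (Fin n) ℝ} {Y : Matrix (Fin m) (Fin n) ℝ} {γ δ : ℝ}
  {w : ℝ → Fin q → ℝ} {e : ℝ → Fin n → ℝ}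

/-- The algebraic constraint hidden in the equation, as `Eperp` annihilates `d/dt (E e)`. -/
theorem IsDAESolution.algebraic_eq (he : IsDAESolution E A B w e) (hEperp : Eperp * E = 0) :
    ∀ᵐ t ∂(volume.restrict (Ici (0 : ℝ))), Eperp *ᵥ (A *ᵥ e t + B *ᵥ w t) = 0 := by
  filter_upwards [he.eqn] with t ht
  have h := ht.mulVec Eperp
  simp only [mulVec_mulVec _ Eperp E, hEperp, zero_mulVec] at h
  exact h.unique (hasDerivAt_const t 0)

theorem IsDAESolution.deriv_storage (he : IsDAESolution E A B w e) (hEperp : Eperp * E = 0)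
    (hX : Xᵀ = X) :
    ∀ᵐ t ∂(volume.restrict (Ici (0 : ℝ))),
      deriv (fun τ => (E *ᵥ e τ) ⬝ᵥ (X *ᵥ (E *ᵥ e τ))) t =
        2 * ((lyapMatrix E Eperp X Y *ᵥ e t) ⬝ᵥ (A *ᵥ e t + B *ᵥ w t)) := by
  filter_upwards [he.eqn, he.algebraic_eq hEperp] with t ht hp
  rw [(ht.quadForm hX).deriv, lyapMatrix_dotProduct, hp, dotProduct_zero, add_zero]

/-- The storage function decays to zero and hence so does `E e`; the remaining components of `e` are
controlled by the algebraic constraint `Eperp A e = 0`, since the dissipation inequality forces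
`x = 0` whenever `E x = 0` and `Eperp A x = 0`. -/
theorem IsDAESolution.tendsto_zero (hEperp : Eperp * E = 0) (hX : X.PosDef) (hδ : 0 < δ)
    (hdiss : IsDissipative A B Γ (lyapMatrix E Eperp X Y) γ δ)
    (he : IsDAESolution E A B w e) (hw : ∀ t, 0 ≤ t → w t = 0) (hcont : ContinuousOn e (Ici 0)) :
    Tendsto e atTop (𝓝 0) := by
  have hXt : Xᵀ = X := hX.transpose_eq
  have hXnn : ∀ y : Fin n → ℝ, 0 ≤ y ⬝ᵥ (X *ᵥ y) := hX.quadForm_nonneg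
  have hdiss0 : ∀ x : Fin n → ℝ,
      2 * ((lyapMatrix E Eperp X Y *ᵥ x) ⬝ᵥ (A *ᵥ x)) + δ * (x ⬝ᵥ x) ≤ 0 := fun x => by
    have h := hdiss x 0
    simp only [mulVec_zero, add_zero, dotProduct_zero, mul_zero] at h
    linarith [dotProduct_self_nonneg_real (Γ *ᵥ x)]
  let V : (Fin n → ℝ) → ℝ := fun x => (E *ᵥ x) ⬝ᵥ (X *ᵥ (E *ᵥ x))
  let G : (Fin n → ℝ) → ℝ := fun x => V x + (Eperp *ᵥ (A *ᵥ x)) ⬝ᵥ (Eperp *ᵥ (A *ᵥ x))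
  have hV2 : ∀ (a : ℝ) x, V (a • x) = a ^ 2 * V x := fun a x => by
    simp only [V, mulVec_smul E, quadForm_smul]
  have hG2 : ∀ (a : ℝ) x, G (a • x) = a ^ 2 * G x := fun a x => by
    simp only [G, hV2, mulVec_smul, dotProduct_self_smul, mul_add]
  have hGpos : ∀ x, x ≠ 0 → 0 < G x := by
    intro x hx
    by_contra hle
    have h1 : 0 ≤ V x := hXnn _
    have h2 := dotProduct_self_nonneg_real (Eperp *ᵥ (A *ᵥ x))
    have h3 : V x + (Eperp *ᵥ (A *ᵥ x)) ⬝ᵥ (Eperp *ᵥ (A *ᵥ x)) ≤ 0 := not_lt.1 hle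
    have hp : Eperp *ᵥ (A *ᵥ x) = 0 := dotProduct_self_eq_zero.1 (by linarith)
    have hEx : E *ᵥ x = 0 := by
      by_contra hne
      have h4 : 0 < V x := hX.quadForm_pos hne
      linarith
    have h5 := hdiss0 x
    rw [lyapMatrix_dotProduct, hp, hEx, mulVec_zero, zero_dotProduct, dotProduct_zero] at h5
    linarith [mul_pos hδ (dotProduct_self_pos hx)]
  obtain ⟨c, hc, hVc⟩ := exists_pos_le_mul_of_homogeneous (f := V) (g := fun x => x ⬝ᵥ x)
    (by fun_prop) (by fun_prop) hV2 dotProduct_self_smul fun x hx => dotProduct_self_pos hx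
  obtain ⟨k, hk, hGk⟩ := exists_pos_le_mul_of_homogeneous (f := fun x => x ⬝ᵥ x) (g := G)
    (by fun_prop) (by fun_prop) dotProduct_self_smul hG2 hGpos
  have hVlim : Tendsto (fun t => V (e t)) atTop (𝓝 0) := by
    refine tendsto_zero_of_deriv_le (div_pos hδ hc) (fun T hT => (he.absCont T hT).quadForm X)
      (fun t => hXnn _) ?_
    filter_upwards [he.deriv_storage (Y := Y) hEperp hXt, ae_restrict_mem measurableSet_Ici]
      with t ht ht0
    have h1 := hdiss0 (e t)
    have h2 : δ / c * V (e t) ≤ δ * (e t ⬝ᵥ e t) := by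
      rw [div_mul_eq_mul_div, div_le_iff₀ hc, mul_assoc, mul_comm _ c]
      exact mul_le_mul_of_nonneg_left (hVc _) hδ.le
    rw [hw t ht0, mulVec_zero, add_zero] at ht
    change deriv (fun τ => (E *ᵥ e τ) ⬝ᵥ (X *ᵥ (E *ᵥ e τ))) t ≤ _
    linarith
  -- Continuity of `e` upgrades the constraint from almost every to every time.
  have halg : EqOn (fun t => Eperp *ᵥ (A *ᵥ e t)) (fun _ => 0) (Ici 0) := by
    refine Measure.eqOn_of_ae_eq (μ := volume) ?_ (by fun_prop) continuousOn_const ?_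
    · filter_upwards [he.algebraic_eq hEperp, ae_restrict_mem measurableSet_Ici] with t ht ht0
      rwa [hw t ht0, mulVec_zero, add_zero] at ht
    · rw [interior_Ici, closure_Ioi]
  have hsq : Tendsto (fun t => e t ⬝ᵥ e t) atTop (𝓝 0) := by
    refine squeeze_zero' (.of_forall fun t => dotProduct_self_nonneg_real _)
      ((eventually_ge_atTop 0).mono fun t ht => ?_) (by simpa using hVlim.const_mul k)
    have h1 := hGk (e t)
    have h2 : Eperp *ᵥ (A *ᵥ e t) = 0 := halg ht
    simpa only [G, h2, dotProduct_zero, add_zero] using h1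
  refine tendsto_pi_nhds.2 fun i => ?_
  have hi : Tendsto (fun t => e t i * e t i) atTop (𝓝 0) :=
    squeeze_zero (fun t => mul_self_nonneg _) (fun t => Finset.single_le_sum
      (f := fun j => e t j * e t j) (fun j _ => mul_self_nonneg _) (Finset.mem_univ i)) hsq
  rw [Pi.zero_apply, tendsto_zero_iff_abs_tendsto_zero]
  have h := (Real.continuous_sqrt.tendsto 0).comp hi
  simpa [Function.comp_def, Real.sqrt_mul_self_eq_abs] using h

/-! ### The `L²` bound -/

theorem l2NormSq_eq_lintegral {k : ℕ} (S : Set ℝ) (f : ℝ → Fin k → ℝ) :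
    l2NormSq S f = ∫⁻ t in S, ENNReal.ofReal (f t ⬝ᵥ f t) := by
  have h := eLpNorm_nnreal_pow_eq_lintegral (f := euclSignal f) (μ := volume.restrict S)
    (p := 2) two_ne_zero
  simp only [NNReal.coe_ofNat, ENNReal.coe_ofNat, ENNReal.rpow_ofNat] at h
  rw [l2NormSq, h]
  refine lintegral_congr fun t => ?_
  rw [← ofReal_norm, ← ENNReal.ofReal_pow (norm_nonneg _), EuclideanSpace.real_norm_sq_eq]
  simp [euclSignal, dotProduct, sq]

theorem euclSignal_norm_sq {k : ℕ} (f : ℝ → Fin k → ℝ) (t : ℝ) :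
    ‖euclSignal f t‖ ^ 2 = f t ⬝ᵥ f t := by
  rw [EuclideanSpace.real_norm_sq_eq]
  simp [euclSignal, dotProduct, sq]

theorem l2NormSq_ne_zero {k : ℕ} {S : Set ℝ} {f : ℝ → Fin k → ℝ}
    (hf : AEStronglyMeasurable (euclSignal f) (volume.restrict S))
    (h : ¬ f =ᵐ[volume.restrict S] 0) : l2NormSq S f ≠ 0 := by
  rw [l2NormSq, Ne, pow_eq_zero_iff two_ne_zero, eLpNorm_eq_zero_iff hf two_ne_zero]
  refine fun h0 => h ?_
  filter_upwards [h0] with t ht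
  exact (WithLp.toLp_injective 2) ht

/-- The dissipation inequality integrated over `[0, T]`. Splitting the lower integral of
`‖Γ e‖² + δ ‖w‖²` only needs `‖w‖²` to be measurable, and `‖e‖²` is dropped from the inequality before
integrating, so no regularity of `e` beyond that of `E e` enters. -/
theorem IsDAESolution.l2NormSq_add_le (hEperp : Eperp * E = 0) (hX : X.PosDef) (hδ : 0 < δ)
    (hdiss : IsDissipative A B Γ (lyapMatrix E Eperp X Y) γ δ)
    (he : IsDAESolution E A B w e) (h0 : E *ᵥ e 0 = 0) {T : ℝ} (hT : 0 < T)
    (hw : MemLp (euclSignal w) 2 (volume.restrict (Icc 0 T))) :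
    l2NormSq (Icc 0 T) (fun t => Γ *ᵥ e t) + ENNReal.ofReal δ * l2NormSq (Icc 0 T) w ≤
      ENNReal.ofReal γ * l2NormSq (Icc 0 T) w := by
  have hXt : Xᵀ = X := hX.transpose_eq
  let V : ℝ → ℝ := fun t => (E *ᵥ e t) ⬝ᵥ (X *ᵥ (E *ᵥ e t))
  have hV : AbsolutelyContinuousOnInterval V 0 T := (he.absCont T hT).quadForm X
  have hwint : Integrable (fun t => w t ⬝ᵥ w t) (volume.restrict (Icc 0 T)) := by
    simpa only [euclSignal_norm_sq] using (memLp_two_iff_integrable_sq_norm hw.1).1 hw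
  have hVint : Integrable (deriv V) (volume.restrict (Icc 0 T)) :=
    integrableOn_Icc_iff_integrableOn_Ioc (by finiteness) |>.2
      ((intervalIntegrable_iff_integrableOn_Ioc_of_le hT.le).1 hV.intervalIntegrable_deriv)
  have hVT : 0 ≤ ∫ t in Icc 0 T, deriv V t := by
    rw [integral_Icc_eq_integral_Ioc, ← intervalIntegral.integral_of_le hT.le,
      hV.integral_deriv_eq_sub]
    have h1 : 0 ≤ V T := hX.quadForm_nonneg (E *ᵥ e T)
    have h2 : V 0 = 0 := by simp only [V, h0, zero_dotProduct]
    linarith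
  have hle : ∀ᵐ t ∂(volume.restrict (Icc 0 T)),
      (Γ *ᵥ e t) ⬝ᵥ (Γ *ᵥ e t) + δ * (w t ⬝ᵥ w t) ≤ γ * (w t ⬝ᵥ w t) - deriv V t := by
    filter_upwards [ae_restrict_of_ae_restrict_of_subset
      (Icc_subset_Ici_self : Icc 0 T ⊆ Ici 0) (he.deriv_storage (Y := Y) hEperp hXt)] with t ht
    have h1 := hdiss (e t) (w t)
    have h2 := mul_nonneg hδ.le (dotProduct_self_nonneg_real (e t))
    change deriv V t = _ at ht
    linarith
  have hmeas : AEMeasurable (fun t => ENNReal.ofReal δ * ENNReal.ofReal (w t ⬝ᵥ w t))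
      (volume.restrict (Icc 0 T)) := (hwint.aemeasurable.ennreal_ofReal).const_mul _
  simp only [l2NormSq_eq_lintegral]
  calc (∫⁻ t in Icc 0 T, ENNReal.ofReal ((Γ *ᵥ e t) ⬝ᵥ (Γ *ᵥ e t))) +
        ENNReal.ofReal δ * ∫⁻ t in Icc 0 T, ENNReal.ofReal (w t ⬝ᵥ w t)
      = ∫⁻ t in Icc 0 T, (ENNReal.ofReal ((Γ *ᵥ e t) ⬝ᵥ (Γ *ᵥ e t)) +
          ENNReal.ofReal δ * ENNReal.ofReal (w t ⬝ᵥ w t)) := by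
        rw [lintegral_add_right' _ hmeas, lintegral_const_mul' _ _ ENNReal.ofReal_ne_top]
    _ = ∫⁻ t in Icc 0 T, ENNReal.ofReal ((Γ *ᵥ e t) ⬝ᵥ (Γ *ᵥ e t) + δ * (w t ⬝ᵥ w t)) := by
        refine lintegral_congr fun t => ?_
        rw [ENNReal.ofReal_add (dotProduct_self_nonneg_real _)
          (mul_nonneg hδ.le (dotProduct_self_nonneg_real _)), ENNReal.ofReal_mul hδ.le]
    _ ≤ ∫⁻ t in Icc 0 T, ENNReal.ofReal (γ * (w t ⬝ᵥ w t) - deriv V t) :=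
        lintegral_mono_ae (hle.mono fun t ht => ENNReal.ofReal_le_ofReal ht)
    _ = ENNReal.ofReal (∫ t in Icc 0 T, (γ * (w t ⬝ᵥ w t) - deriv V t)) := by
        refine (ofReal_integral_eq_lintegral_ofReal ((hwint.const_mul γ).sub hVint) ?_).symm
        filter_upwards [hle] with t ht
        exact (add_nonneg (dotProduct_self_nonneg_real _)
          (mul_nonneg hδ.le (dotProduct_self_nonneg_real _))).trans ht
    _ ≤ ENNReal.ofReal (γ * ∫ t in Icc 0 T, w t ⬝ᵥ w t) := by
        refine ENNReal.ofReal_le_ofReal ?_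
        rw [integral_sub (hwint.const_mul γ) hVint, integral_const_mul]
        linarith
    _ = ENNReal.ofReal γ * ∫⁻ t in Icc 0 T, ENNReal.ofReal (w t ⬝ᵥ w t) := by
        rw [ENNReal.ofReal_mul' (integral_nonneg fun t => dotProduct_self_nonneg_real (w t)),
          ofReal_integral_eq_lintegral_ofReal hwint
            (.of_forall fun t => dotProduct_self_nonneg_real (w t))]

theorem l2NormSq_lt_of_add_le {k l : ℕ} {S : Set ℝ} {f : ℝ → Fin k → ℝ} {w : ℝ → Fin l → ℝ}
    (hδ : 0 < δ) (hw : MemLp (euclSignal w) 2 (volume.restrict S))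
    (hw0 : ¬ w =ᵐ[volume.restrict S] 0)
    (h : l2NormSq S f + ENNReal.ofReal δ * l2NormSq S w ≤ ENNReal.ofReal γ * l2NormSq S w) :
    l2NormSq S f < ENNReal.ofReal γ * l2NormSq S w := by
  have hfin : ENNReal.ofReal γ * l2NormSq S w ≠ ⊤ :=
    ENNReal.mul_ne_top ENNReal.ofReal_ne_top (ENNReal.pow_ne_top hw.2.ne)
  refine (ENNReal.lt_add_right (ne_top_of_le_ne_top hfin (le_self_add.trans h)) ?_).trans_le h
  exact mul_ne_zero (ENNReal.ofReal_pos.2 hδ).ne' (l2NormSq_ne_zero hw.1 hw0)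

theorem l2NormSq_Ici_eq_iSup {k : ℕ} (f : ℝ → Fin k → ℝ) :
    l2NormSq (Ici 0) f = ⨆ N : ℕ, l2NormSq (Icc 0 ((N : ℝ) + 1)) f := by
  have hU : (⋃ N : ℕ, Icc (0 : ℝ) ((N : ℝ) + 1)) = Ici 0 := by
    ext t
    simp only [mem_iUnion, mem_Icc, mem_Ici]
    refine ⟨fun ⟨_, h⟩ => h.1, fun h => ?_⟩
    obtain ⟨N, hN⟩ := exists_nat_ge t
    exact ⟨N, h, by linarith⟩
  have hmono : Monotone fun N : ℕ => Icc (0 : ℝ) ((N : ℝ) + 1) := fun a b hab =>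
    Icc_subset_Icc_right (by simpa using hab)
  simp only [l2NormSq_eq_lintegral]
  rw [← hU, setLIntegral_iUnion_of_directed _ hmono.directed_le]

/-- The slack `δ ‖w‖²`, positive and finite, makes the integrated inequality strict; over `[0, ∞)` the
inequality is the supremum of those over bounded horizons. -/
theorem IsDAESolution.l2Performance (hEperp : Eperp * E = 0) (hX : X.PosDef) (hδ : 0 < δ)
    (hdiss : IsDissipative A B Γ (lyapMatrix E Eperp X Y) γ δ)
    (he : IsDAESolution E A B w e) (h0 : E *ᵥ e 0 = 0) :
    (MemLp (euclSignal w) 2 (volume.restrict (Ici 0)) → ¬ (w =ᵐ[volume.restrict (Ici 0)] 0) →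
      l2NormSq (Ici 0) (fun t => Γ *ᵥ e t) < ENNReal.ofReal γ * l2NormSq (Ici 0) w) ∧
    (MemLp (euclSignal w) ⊤ (volume.restrict (Ici 0)) →
      ∀ T : ℝ, 0 < T → ¬ (w =ᵐ[volume.restrict (Icc 0 T)] 0) →
      l2NormSq (Icc 0 T) (fun t => Γ *ᵥ e t) < ENNReal.ofReal γ * l2NormSq (Icc 0 T) w) := by
  have hsub : ∀ T : ℝ, volume.restrict (Icc 0 T) ≤ volume.restrict (Ici (0 : ℝ)) := fun T =>
    Measure.restrict_mono Icc_subset_Ici_self le_rfl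
  refine ⟨fun hw hw0 => l2NormSq_lt_of_add_le hδ hw hw0 ?_, fun hw T hT hw0 => ?_⟩
  · have hdir : ∀ k : ℕ, ∀ f : ℝ → Fin k → ℝ,
        Monotone fun N : ℕ => l2NormSq (Icc 0 ((N : ℝ) + 1)) f := by
      intro k f a b hab
      simp only [l2NormSq_eq_lintegral]
      exact lintegral_mono_set (Icc_subset_Icc_right (by simpa using hab))
    rw [l2NormSq_Ici_eq_iSup (fun t => Γ *ᵥ e t), l2NormSq_Ici_eq_iSup w, ENNReal.mul_iSup,
      ENNReal.mul_iSup, ENNReal.iSup_add_iSup_of_monotone (hdir _ _)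
        (fun a b hab => mul_le_mul_right (hdir _ w hab) _)]
    exact iSup_mono fun N => he.l2NormSq_add_le hEperp hX hδ hdiss h0 (by positivity)
      (hw.mono_measure (hsub _))
  · have hw2 := (hw.mono_measure (hsub T)).mono_exponent (p := 2) le_top
    exact l2NormSq_lt_of_add_le hδ hw2 hw0 (he.l2NormSq_add_le hEperp hX hδ hdiss h0 hT hw2)

end Trajectory

theorem theorem4 {n r p q : ℕ} (E A : Matrix (Fin n) (Fin n) ℝ)
    (C : Matrix (Fin p) (Fin n) ℝ) (Bw : Matrix (Fin n) (Fin q) ℝ)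
    (Dw : Matrix (Fin p) (Fin q) ℝ) (Γ : Matrix (Fin n) (Fin n) ℝ)
    (Eperp : Matrix (Fin (n - r)) (Fin n) ℝ) (hE : IsOrthComplement E Eperp) (γ : ℝ)
    (hfeas : ∃ (X : Matrix (Fin n) (Fin n) ℝ) (Y : Matrix (Fin (n - r)) (Fin n) ℝ)
      (W : Matrix (Fin p) (Fin n) ℝ), LMIFeasible E A C Bw Dw Γ Eperp γ X Y W) :
    (∃ (X : Matrix (Fin n) (Fin n) ℝ) (Y : Matrix (Fin (n - r)) (Fin n) ℝ)
      (W : Matrix (Fin p) (Fin n) ℝ), LMIFeasible E A C Bw Dw Γ Eperp γ X Y W ∧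
        IsUnit (lyapMatrix E Eperp X Y)) ∧
    ∀ (X : Matrix (Fin n) (Fin n) ℝ) (Y : Matrix (Fin (n - r)) (Fin n) ℝ)
      (W : Matrix (Fin p) (Fin n) ℝ), LMIFeasible E A C Bw Dw Γ Eperp γ X Y W →
      IsUnit (lyapMatrix E Eperp X Y) →
      ∀ L : Matrix (Fin n) (Fin p) ℝ, L = (W * (lyapMatrix E Eperp X Y)⁻¹)ᵀ →
        UndisturbedStable E A C Bw Dw L ∧ L2Performance E A C Bw Dw Γ L γ := by
  refine ⟨?_, fun X Y W h hu L hL => ?_⟩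
  · obtain ⟨X, Y, W, h⟩ := hfeas
    obtain ⟨Y', h', hu⟩ := h.exists_isUnit hE
    exact ⟨X, Y', W, h', hu⟩
  · have hW : W = Lᵀ * lyapMatrix E Eperp X Y := by
      rw [hL, transpose_transpose, nonsing_inv_mul_cancel_right _ _
        ((isUnit_iff_isUnit_det _).1 hu)]
    obtain ⟨δ, hδ, hdiss⟩ := h.exists_isDissipative hW
    exact ⟨⟨isStablePair_of_isDissipative hE.mul_eq_zero h.1 hδ hdiss, fun w e hw he hc =>
      IsDAESolution.tendsto_zero hE.mul_eq_zero h.1 hδ hdiss he hw hc⟩,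
      fun w e he h0 => IsDAESolution.l2Performance hE.mul_eq_zero h.1 hδ hdiss he h0⟩
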